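/- Let $T=\mathbb R/2\pi\mathbb Z$ and let $C(T)$ be the space of continuous complex-valued functions on $T$, with $\|f\|=\max_{x\in T}|f(x)|$. For $f\in C(T)$, $r\in\mathbb N$, $x \in T$ and $h\in\mathbb R$ put $$\Delta_h^{r}f(x)=\sum_{i=0}^{r}(-1)^{r-i}\binom{r}{i}f\bigl(x-\tfrac r2h+ih\bigr),\qquad \omega_r(f,\delta)=\sup_{x\in T,\ |h|<\delta}|\Delta_h^rf(x)|\quad(\delta>0).$$ Let $s_if(t)=\sum_{j=-i}^{i}\hat f(j)e^{ijt}$, where $\hat f(j)=\frac1{2\pi}\int_{-\pi}^{\pi}f(t)e^{-ijt}\,dt$, be the $i$-th partial Fourier sum of $f$, and let $\alpha:=2^{-5/2}3^{1/2}\pi$. **Theorem 3.** For all integers $k\ge1$ and $m\ge2$ and every $f\in C(T)$, the de la Vallée Poussin means $$v_{k,m}f=\frac1m\sum_{i=km}^{(k+1)m-1}s_if$$ satisfy $$\|f-v_{k,m}f\|\le\frac{2(k+1)^2}{\binom{2k}{k}}\;\omega_{2k}\Bigl(f,\frac{2\pi}{km}\,\alpha\Bigr).$$ -/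

import Mathlib

open Real

noncomputable section

namespace VallePoussin

/-- The circle `ℝ / 2πℤ`. -/
abbrev T : Type := AddCircle (2 * π)

instance factTwoPiPos : Fact (0 < 2 * π) := ⟨Real.two_pi_pos⟩

/-- The constant `α = 2 ^ (-5/2) * 3 ^ (1/2) * π`. -/
def alpha : ℝ := (2 : ℝ) ^ (-(5 / 2) : ℝ) * (3 : ℝ) ^ (1 / 2 : ℝ) * π

/-- The symmetric difference of order `r` with step `h` at the point `x`:
`∑_{i=0}^r (-1)^(r-i) (r choose i) f (x - (r/2) h + i h)`. -/
def symmDiff (r : ℕ) (h : ℝ) (f : C(T, ℂ)) (x : T) : ℂ :=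
  ∑ i ∈ Finset.range (r + 1),
    (-1 : ℂ) ^ (r - i) * (r.choose i : ℂ) * f (x + ((-((r : ℝ) / 2) * h + (i : ℝ) * h : ℝ) : T))

/-- The modulus of smoothness of order `r`: the supremum of `|Δ_h^r f(x)|`
over all `x` and all real `h` with `|h| < δ`. -/
def modulus (r : ℕ) (f : C(T, ℂ)) (δ : ℝ) : ℝ :=
  sSup {y : ℝ | ∃ (x : T) (h : ℝ), |h| < δ ∧ y = ‖symmDiff r h f x‖}

/-- The set in the definition of the modulus is bounded, so that its `sSup` is a true supremum. -/
theorem modulus_bddAbove (r : ℕ) (f : C(T, ℂ)) (δ : ℝ) :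
    BddAbove {y : ℝ | ∃ (x : T) (h : ℝ), |h| < δ ∧ y = ‖symmDiff r h f x‖} := by
  refine ⟨∑ i ∈ Finset.range (r + 1), (r.choose i : ℝ) * ‖f‖, ?_⟩
  rintro y ⟨x, h, -, rfl⟩
  refine (norm_sum_le _ _).trans (Finset.sum_le_sum fun i _ => ?_)
  rw [norm_mul, norm_mul, norm_pow, norm_neg, norm_one, one_pow, one_mul, Complex.norm_natCast]
  exact mul_le_mul_of_nonneg_left (f.norm_coe_le_norm _) (Nat.cast_nonneg _)

/-- The partial Fourier sum `s_i f = ∑_{j=-i}^{i} f̂(j) e^{ijt}`. -/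
def partialSum (i : ℕ) (f : C(T, ℂ)) : C(T, ℂ) :=
  ∑ j ∈ Finset.Icc (-(i : ℤ)) (i : ℤ), fourierCoeff (⇑f) j • fourier j

/-- The de la Vallée Poussin mean `v_{k,m} f = (1/m) ∑_{i=km}^{(k+1)m-1} s_i f`. -/
def vpMean (k m : ℕ) (f : C(T, ℂ)) : C(T, ℂ) :=
  (1 / (m : ℂ)) • ∑ i ∈ Finset.Ico (k * m) ((k + 1) * m), partialSum i f

end VallePoussin

end

/-! Write n = km, h = 2πα/n, C = binom(2k,k), v for the mean and g = f - v f. Since v reproduces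
every frequency |j| ≤ n, g has only frequencies |j| > n. Let S be the average of the differences of
order 2k with steps th, 0 ≤ t ≤ 1, against the weight 2(1 - t). Then ‖S f‖ ≤ ω_{2k}(f, h), and S
commutes with v because both are Fourier multipliers.

Upper bound: v is a combination of two Fejér means, so ‖v‖ ≤ 2k + 1 and ‖S g‖ = ‖S f - v S f‖ ≤ 2(k
+ 1) ω_{2k}(f, h).

Lower bound (`norm_le_norm_steklov`): the central term of the difference contributes ± C g to S g.
In every other term the triangular weight has cosine transform (2 - 2 cos u)/u², so that term is a
second difference of a second antiderivative of g, divided by ((i - k)h)². High frequencies make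
this antiderivative small: it is the convolution of g with a kernel whose coefficients are 1/j² for
|j| ≥ n, and the L¹ norm of that kernel is at most (13/5)/n² (`integral_norm_invSqKernel_le`). As
noncentral binomial coefficients are at most k/(k + 1) times C, the choice of α bounds the sum of
these terms by k/(k + 1) · C‖g‖. Hence C‖g‖ ≤ (k + 1)‖S g‖, and the two bounds combine. -/

noncomputable section

namespace VallePoussin

open MeasureTheory AddCircle

/-! ### Fourier coefficients, translation and convolution -/

/-- The `j`-th Fourier coefficient as a continuous linear functional on `C(T, ℂ)`. -/
def coeffL (j : ℤ) : C(T, ℂ) →L[ℂ] ℂ :=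
  LinearMap.mkContinuous
    { toFun := fun f => fourierCoeff (⇑f) j
      map_add' := fun f g => by
        simp only [fourierCoeff, ContinuousMap.coe_add, Pi.add_apply, smul_add]
        exact integral_add
          ((by fun_prop : Continuous fun t : T => fourier (-j) t • f t).integrable_of_hasCompactSupport
            (HasCompactSupport.of_compactSpace _))
          ((by fun_prop : Continuous fun t : T => fourier (-j) t • g t).integrable_of_hasCompactSupport
            (HasCompactSupport.of_compactSpace _))
      map_smul' := fun c f => by
        simp only [ContinuousMap.coe_smul, RingHom.id_apply]
        exact fourierCoeff.const_smul _ _ _ } 1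
    (fun f => by
      simp only [LinearMap.coe_mk, AddHom.coe_mk, fourierCoeff, one_mul]
      refine (norm_integral_le_of_norm_le_const (C := ‖f‖)
        (Filter.Eventually.of_forall fun t => ?_)).trans (by simp)
      rw [norm_smul, fourier_apply, Circle.norm_coe, one_mul]
      exact f.norm_coe_le_norm t)

@[simp] theorem coeffL_apply (j : ℤ) (f : C(T, ℂ)) : coeffL j f = fourierCoeff (⇑f) j := rfl

theorem integrable_of_continuous {F : Type*} [NormedAddCommGroup F] {u : T → F}
    (hu : Continuous u) : Integrable u (haarAddCircle (T := 2 * π)) :=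
  hu.integrable_of_hasCompactSupport (HasCompactSupport.of_compactSpace _)

/-- A continuous function on the circle is determined by its Fourier coefficients. -/
theorem ext_fourierCoeff {f g : C(T, ℂ)}
    (h : ∀ j : ℤ, fourierCoeff (⇑f) j = fourierCoeff (⇑g) j) : f = g := by
  apply ContinuousMap.toLp_injective (p := 2) (𝕜 := ℂ) (haarAddCircle (T := 2 * π))
  apply fourierBasis.repr.injective
  ext j
  rw [fourierBasis_repr, fourierBasis_repr, fourierCoeff_toLp, fourierCoeff_toLp, h]

theorem fourierCoeff_fourier (i j : ℤ) :
    fourierCoeff (⇑(fourier i : C(T, ℂ))) j = if i = j then 1 else 0 := by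
  have := orthonormal_iff_ite.1 (orthonormal_fourier (T := 2 * π)) j i
  rw [← fourierCoeff_toLp, ← fourierBasis_repr, HilbertBasis.repr_apply_apply, coe_fourierBasis]
  convert this using 2
  simp [eq_comm]

/-- Translation `f ↦ f (· + s)`. -/
def translate (s : T) (f : C(T, ℂ)) : C(T, ℂ) := ⟨fun x => f (x + s), by fun_prop⟩

@[simp] theorem translate_apply (s : T) (f : C(T, ℂ)) (x : T) : translate s f x = f (x + s) := rfl

theorem norm_translate_le (s : T) (f : C(T, ℂ)) : ‖translate s f‖ ≤ ‖f‖ :=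
  (ContinuousMap.norm_le _ (norm_nonneg _)).2 fun _ => f.norm_coe_le_norm _

theorem continuous_translate (f : C(T, ℂ)) : Continuous fun s => translate s f :=
  (ContinuousMap.curry ⟨fun p : T × T => f (p.2 + p.1), by fun_prop⟩).continuous

theorem fourierCoeff_translate (s : T) (f : C(T, ℂ)) (j : ℤ) :
    fourierCoeff (⇑(translate s f)) j = fourier j s * fourierCoeff (⇑f) j := by
  have h := integral_add_right_eq_self (μ := haarAddCircle (T := 2 * π))
    (fun t : T => fourier (-j) (t - s) * f t) s
  simp only [add_sub_cancel_right] at h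
  simp only [fourierCoeff, smul_eq_mul, translate_apply]
  rw [h, ← integral_const_mul]
  congr 1
  ext t
  have : (fourier (-j) (t - s) : ℂ) = fourier (-j) t * fourier j s := by
    have e : -j • (t - s) = -j • t + j • s := by rw [smul_sub, neg_smul j s, sub_neg_eq_add]
    simp only [fourier_apply, e, toCircle_add, Circle.coe_mul]
  rw [this]; ring

/-- Convolution `f ↦ ∫ K(t) f(· - t) dt` for the normalised Haar measure. -/
def conv (K f : C(T, ℂ)) : C(T, ℂ) := ∫ t : T, K t • translate (-t) f ∂haarAddCircle

theorem continuous_smul_translate (K f : C(T, ℂ)) :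
    Continuous fun t : T => K t • translate (-t) f :=
  K.continuous.smul ((continuous_translate f).comp continuous_neg)

theorem fourierCoeff_conv (K f : C(T, ℂ)) (j : ℤ) :
    fourierCoeff (⇑(conv K f)) j = fourierCoeff (⇑K) j * fourierCoeff (⇑f) j := by
  rw [← coeffL_apply, conv, ← (coeffL j).integral_comp_comm
    (integrable_of_continuous (continuous_smul_translate K f))]
  simp only [map_smul, coeffL_apply, fourierCoeff_translate, smul_eq_mul]
  generalize fourierCoeff (⇑f) j = c
  rw [fourierCoeff, ← integral_mul_const]
  congr 1
  ext t
  have : (fourier j (-t) : ℂ) = fourier (-j) t := by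
    simp only [fourier_apply, smul_neg, neg_smul]
  rw [this, smul_eq_mul]; ring

theorem norm_conv_le (K f : C(T, ℂ)) :
    ‖conv K f‖ ≤ (∫ t : T, ‖K t‖ ∂haarAddCircle) * ‖f‖ := by
  rw [conv, ← integral_mul_const]
  refine norm_integral_le_of_norm_le
    (integrable_of_continuous (K.continuous.norm.mul continuous_const))
    (Filter.Eventually.of_forall fun t => ?_)
  rw [norm_smul]
  exact mul_le_mul_of_nonneg_left (norm_translate_le _ _) (norm_nonneg _)

/-! ### Fejér kernels and the norm of the de la Vallée Poussin means -/

theorem fourierCoeff_partialSum (i : ℕ) (f : C(T, ℂ)) (l : ℤ) :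
    fourierCoeff (⇑(partialSum i f)) l =
      if l ∈ Finset.Icc (-(i : ℤ)) i then fourierCoeff (⇑f) l else 0 := by
  rw [← coeffL_apply, partialSum, map_sum]
  simp only [map_smul, coeffL_apply, fourierCoeff_fourier, smul_eq_mul, mul_ite, mul_one, mul_zero]
  rw [Finset.sum_ite_eq']

/-- The Dirichlet kernel. -/
def dirichlet (i : ℕ) : C(T, ℂ) := ∑ j ∈ Finset.Icc (-(i : ℤ)) (i : ℤ), fourier j

theorem fourierCoeff_dirichlet (i : ℕ) (l : ℤ) :
    fourierCoeff (⇑(dirichlet i)) l = if l ∈ Finset.Icc (-(i : ℤ)) i then 1 else 0 := by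
  rw [← coeffL_apply, dirichlet, map_sum]
  simp only [coeffL_apply, fourierCoeff_fourier]
  rw [Finset.sum_ite_eq']

/-- `N` times the Fejér kernel. -/
def fejerSum (N : ℕ) : C(T, ℂ) := ∑ i ∈ Finset.range N, dirichlet i

theorem sum_partialSum_eq_conv (N : ℕ) (f : C(T, ℂ)) :
    ∑ i ∈ Finset.range N, partialSum i f = conv (fejerSum N) f := by
  refine ext_fourierCoeff fun l => ?_
  rw [fourierCoeff_conv, ← coeffL_apply, ← coeffL_apply, fejerSum, map_sum, map_sum,
    Finset.sum_mul]
  refine Finset.sum_congr rfl fun i _ => ?_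
  rw [coeffL_apply, coeffL_apply, fourierCoeff_partialSum, fourierCoeff_dirichlet, ite_mul, one_mul,
    zero_mul]

theorem dirichlet_succ (N : ℕ) :
    dirichlet (N + 1) = dirichlet N + fourier ((N : ℤ) + 1) + fourier (-((N : ℤ) + 1)) := by
  have h : Finset.Icc (-((N + 1 : ℕ) : ℤ)) ((N + 1 : ℕ) : ℤ) =
      insert (-((N : ℤ) + 1)) (insert ((N : ℤ) + 1) (Finset.Icc (-(N : ℤ)) N)) := by
    ext x
    simp only [Finset.mem_Icc, Finset.mem_insert]
    push_cast
    omega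
  rw [dirichlet, h, Finset.sum_insert, Finset.sum_insert, dirichlet]
  · abel
  · simp
  · simp only [Finset.mem_Icc, Finset.mem_insert]
    omega

theorem dirichlet_eq (N : ℕ) :
    dirichlet N = 1 + ∑ j ∈ Finset.range N,
      (fourier ((j : ℤ) + 1) + fourier (-((j : ℤ) + 1)) : C(T, ℂ)) := by
  induction N with
  | zero =>
    ext x
    simp [dirichlet]
  | succ N ih => rw [dirichlet_succ, ih, Finset.sum_range_succ]; abel

/-- Passing from N to N + 1 adds e^{iNt} to the exponential sum; the cross terms in the squared
modulus, plus 1, are exactly the Dirichlet kernel of order N. What matters later is positivity. -/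
theorem fejerSum_apply (N : ℕ) (t : T) :
    fejerSum N t = ((‖∑ j ∈ Finset.range N, (fourier (j : ℤ) t : ℂ)‖ ^ 2 : ℝ) : ℂ) := by
  induction N with
  | zero => simp [fejerSum]
  | succ N ih =>
    have key : (dirichlet N t : ℂ) = 1 +
        (∑ j ∈ Finset.range N, (fourier (j : ℤ) t : ℂ)) * fourier (-(N : ℤ)) t +
        fourier (N : ℤ) t * ∑ j ∈ Finset.range N, (fourier (-(j : ℤ)) t : ℂ) := by
      rw [dirichlet_eq, Finset.sum_add_distrib, Finset.sum_mul, Finset.mul_sum]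
      rw [← Finset.sum_range_reflect (fun j => (fourier ((j : ℤ) + 1) : C(T, ℂ))),
        ← Finset.sum_range_reflect (fun j => (fourier (-((j : ℤ) + 1)) : C(T, ℂ)))]
      simp only [ContinuousMap.add_apply, ContinuousMap.one_apply, ContinuousMap.sum_apply,
        ← fourier_add]
      rw [add_assoc, add_comm (Finset.sum _ _)]
      congr 2
      · refine Finset.sum_congr rfl fun j hj => ?_
        have := Finset.mem_range.1 hj
        congr 2; omega
      · refine Finset.sum_congr rfl fun j hj => ?_
        have := Finset.mem_range.1 hj
        congr 2; omega
    rw [fejerSum, Finset.sum_range_succ, ← fejerSum, ContinuousMap.add_apply, ih, key,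
      Finset.sum_range_succ]
    simp only [← Complex.normSq_eq_norm_sq, Complex.normSq_eq_conj_mul_self, map_add, map_sum,
      ← fourier_neg]
    have h1 : (fourier (-(N : ℤ)) t : ℂ) * fourier (N : ℤ) t = 1 := by
      rw [← fourier_add, neg_add_cancel, fourier_zero]
    linear_combination h1 * (-1)

/-- By positivity the L¹ norm is the zeroth Fourier coefficient, to which each Dirichlet kernel
contributes 1. -/
theorem integral_norm_fejerSum (N : ℕ) : ∫ t : T, ‖fejerSum N t‖ ∂haarAddCircle = N := by
  have h1 : fourierCoeff (⇑(fejerSum N)) 0 = N := by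
    rw [← coeffL_apply, fejerSum, map_sum]
    simp [fourierCoeff_dirichlet]
  have h2 : fourierCoeff (⇑(fejerSum N)) 0 =
      ((∫ t : T, ‖fejerSum N t‖ ∂haarAddCircle : ℝ) : ℂ) := by
    rw [fourierCoeff, ← integral_complex_ofReal]
    refine integral_congr_ae (Filter.Eventually.of_forall fun t => ?_)
    simp only [neg_zero, fourier_zero, one_smul, fejerSum_apply, Complex.norm_real, norm_pow,
      norm_norm]
  exact_mod_cast h2.symm.trans h1

theorem norm_sum_partialSum_le (N : ℕ) (f : C(T, ℂ)) :
    ‖∑ i ∈ Finset.range N, partialSum i f‖ ≤ N * ‖f‖ := by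
  rw [sum_partialSum_eq_conv, ← integral_norm_fejerSum N]
  exact norm_conv_le _ _

theorem norm_vpMean_le (k m : ℕ) (hm : 0 < m) (f : C(T, ℂ)) :
    ‖vpMean k m f‖ ≤ (2 * k + 1) * ‖f‖ := by
  have hm' : (0 : ℝ) < m := Nat.cast_pos.2 hm
  -- The mean is a difference of two Fejér-type sums, of lengths (k + 1)m and km; hence the factor
  -- ((k + 1)m + km)/m = 2k + 1.
  rw [vpMean, Finset.sum_Ico_eq_sub _ (Nat.mul_le_mul_right m k.le_succ), norm_smul]
  have h := (norm_sub_le (∑ i ∈ Finset.range ((k + 1) * m), partialSum i f)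
    (∑ i ∈ Finset.range (k * m), partialSum i f)).trans
    (add_le_add (norm_sum_partialSum_le _ f) (norm_sum_partialSum_le _ f))
  calc _ ≤ ‖(1 / (m : ℂ))‖ * (((k + 1) * m : ℕ) * ‖f‖ + (k * m : ℕ) * ‖f‖) :=
        mul_le_mul_of_nonneg_left h (norm_nonneg _)
    _ = _ := by
        rw [norm_div, norm_one, Complex.norm_natCast]
        push_cast
        field_simp
        ring

/-- The multiplier of the de la Vallée Poussin mean. -/
def vpMult (k m : ℕ) (l : ℤ) : ℂ :=
  (1 / (m : ℂ)) * ∑ i ∈ Finset.Ico (k * m) ((k + 1) * m),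
    if l ∈ Finset.Icc (-(i : ℤ)) i then 1 else 0

theorem fourierCoeff_vpMean (k m : ℕ) (f : C(T, ℂ)) (l : ℤ) :
    fourierCoeff (⇑(vpMean k m f)) l = vpMult k m l * fourierCoeff (⇑f) l := by
  rw [← coeffL_apply, vpMean, map_smul, map_sum]
  simp only [coeffL_apply, fourierCoeff_partialSum, vpMult, smul_eq_mul, mul_assoc, Finset.sum_mul,
    ite_mul, one_mul, zero_mul]

theorem vpMult_of_abs_le (k m : ℕ) (hm : 0 < m) {l : ℤ} (hl : |l| ≤ (k * m : ℕ)) :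
    vpMult k m l = 1 := by
  have hm' : (m : ℂ) ≠ 0 := Nat.cast_ne_zero.2 hm.ne'
  rw [vpMult, Finset.sum_congr rfl (g := fun _ => (1 : ℂ))]
  · rw [Finset.sum_const, Nat.card_Ico, nsmul_one, add_mul, one_mul, Nat.add_sub_cancel_left]
    field_simp
  · intro i hi
    have h := (Finset.mem_Ico.1 hi).1
    have h' : |l| ≤ (i : ℤ) := hl.trans (by exact_mod_cast h)
    rw [if_pos (Finset.mem_Icc.2 (abs_le.1 h'))]

theorem fourierCoeff_sub_vpMean (k m : ℕ) (f : C(T, ℂ)) (l : ℤ) :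
    fourierCoeff (⇑(f - vpMean k m f)) l = (1 - vpMult k m l) * fourierCoeff (⇑f) l := by
  rw [← coeffL_apply, map_sub, coeffL_apply, coeffL_apply, fourierCoeff_vpMean]
  ring

/-! ### Square sums of the truncated sequence 1/j² and of its differences -/

/-- The even sequence equal to `1 / j ^ 2` for `|j| ≥ n` and constant for `|j| ≤ n`. -/
def invSq (n : ℕ) (j : ℤ) : ℝ := 1 / (max n j.natAbs : ℕ) ^ 2

theorem invSq_nonneg (n : ℕ) (j : ℤ) : 0 ≤ invSq n j := by unfold invSq; positivity

theorem invSq_neg (n : ℕ) (j : ℤ) : invSq n (-j) = invSq n j := by simp [invSq]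

theorem invSq_le {n : ℕ} (hn : 0 < n) (j : ℤ) : invSq n j ≤ 1 / (n : ℝ) ^ 2 := by
  unfold invSq
  gcongr
  exact le_max_left _ _

theorem invSq_of_le {n : ℕ} {j : ℤ} (h : (n : ℤ) ≤ |j|) : invSq n j = 1 / (j : ℝ) ^ 2 := by
  have h' : n ≤ j.natAbs := by rw [Int.abs_eq_natAbs] at h; omega
  rw [invSq, max_eq_right h', Nat.cast_natAbs, Int.cast_abs, sq_abs]

theorem invSq_natCast_sub {n : ℕ} (hn : 0 < n) (j : ℕ) :
    0 ≤ invSq n j - invSq n ((j : ℤ) + 1) ∧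
      invSq n j - invSq n ((j : ℤ) + 1) ≤ 2 / (n : ℝ) ^ 3 := by
  have hn' : (0 : ℝ) < n := Nat.cast_pos.2 hn
  rcases lt_or_ge j n with h | h
  · have : invSq n j = invSq n ((j : ℤ) + 1) := by
      simp only [invSq]
      rw [max_eq_left (by omega), max_eq_left (by omega)]
    rw [this, sub_self]
    exact ⟨le_rfl, by positivity⟩
  · rw [invSq_of_le (by rw [abs_of_nonneg] <;> omega), invSq_of_le (by rw [abs_of_nonneg] <;> omega)]
    push_cast
    have hj : (n : ℝ) ≤ j := Nat.cast_le.2 h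
    have hj' : (0 : ℝ) < j := hn'.trans_le hj
    have e : 1 / (j : ℝ) ^ 2 - 1 / ((j : ℝ) + 1) ^ 2 =
        (2 * j + 1) / ((j : ℝ) ^ 2 * ((j : ℝ) + 1) ^ 2) := by
      field_simp
      ring
    rw [e]
    refine ⟨by positivity, ?_⟩
    calc _ ≤ 2 / (j : ℝ) ^ 3 := by
          rw [div_le_div_iff₀ (by positivity) (by positivity)]
          nlinarith [pow_pos hj' 2, pow_pos hj' 3]
      _ ≤ _ := by gcongr

theorem sum_invSq_shift_le {n : ℕ} (hn : 0 < n) (J : ℕ) :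
    ∑ i ∈ Finset.range J, invSq n ((i + (n + 1) : ℕ) : ℤ) ≤ 1 / (n : ℝ) := by
  have hn' : (0 : ℝ) < n := Nat.cast_pos.2 hn
  -- A telescoping bound makes the induction close: 1/(n+J+1)² ≤ 1/(n+J) - 1/(n+J+1).
  suffices h : ∑ i ∈ Finset.range J, invSq n ((i + (n + 1) : ℕ) : ℤ) ≤
      1 / (n : ℝ) - 1 / (n + J) from h.trans (sub_le_self _ (by positivity))
  induction J with
  | zero => simp
  | succ J ih =>
    rw [Finset.sum_range_succ, invSq_of_le (by rw [abs_of_nonneg] <;> omega)]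
    refine (add_le_add_left ih _).trans ?_
    push_cast
    have : 1 / ((J : ℝ) + (n + 1)) ^ 2 ≤ 1 / ((n : ℝ) + J) - 1 / (n + (J + 1)) := by
      rw [div_sub_div _ _ (by positivity) (by positivity),
        div_le_div_iff₀ (by positivity) (by positivity)]
      nlinarith [hn', (Nat.cast_nonneg J : (0 : ℝ) ≤ J)]
    linarith

theorem summable_invSq_nat {n : ℕ} (hn : 0 < n) : Summable fun j : ℕ => invSq n j :=
  (summable_nat_add_iff (n + 1)).1
    (summable_of_sum_range_le (fun _ => invSq_nonneg _ _) (sum_invSq_shift_le hn))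

theorem tsum_invSq_nat_le {n : ℕ} (hn : 0 < n) :
    ∑' j : ℕ, invSq n j ≤ (2 * n + 1) / (n : ℝ) ^ 2 := by
  have hn' : (0 : ℝ) < n := Nat.cast_pos.2 hn
  rw [← (summable_invSq_nat hn).sum_add_tsum_nat_add (n + 1)]
  have h1 : ∑ i ∈ Finset.range (n + 1), invSq n i ≤ (n + 1) * (1 / (n : ℝ) ^ 2) := by
    refine (Finset.sum_le_card_nsmul _ (fun i : ℕ => invSq n i) _ fun i _ => invSq_le hn i).trans (le_of_eq ?_)
    rw [Finset.card_range, nsmul_eq_mul]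
    push_cast
    ring
  have h2 : ∑' i : ℕ, invSq n ((i + (n + 1) : ℕ) : ℤ) ≤ 1 / (n : ℝ) :=
    Real.tsum_le_of_sum_range_le (fun _ => invSq_nonneg _ _) (sum_invSq_shift_le hn)
  refine (add_le_add h1 h2).trans (le_of_eq ?_)
  field_simp
  ring

theorem hasSum_invSq {n : ℕ} (hn : 0 < n) :
    HasSum (invSq n) (∑' j : ℕ, invSq n j + (∑' j : ℕ, invSq n j - 1 / (n : ℝ) ^ 2)) := by
  have h0 : HasSum (fun j : ℕ => invSq n ((j : ℕ) : ℤ)) _ := (summable_invSq_nat hn).hasSum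
  have h1 := (hasSum_nat_add_iff' 1).2 h0
  refine HasSum.of_nat_of_neg_add_one h0 ?_
  simp only [Finset.sum_range_one] at h1
  have e : invSq n ((0 : ℕ) : ℤ) = 1 / (n : ℝ) ^ 2 := by simp [invSq]
  rw [e] at h1
  refine h1.congr_fun fun j => ?_
  rw [invSq_neg]
  push_cast
  rfl

theorem summable_invSq {n : ℕ} (hn : 0 < n) : Summable (invSq n) := (hasSum_invSq hn).summable

theorem tsum_sq_invSq_le {n : ℕ} (hn : 2 ≤ n) :
    ∑' j : ℤ, invSq n j ^ 2 ≤ 9 / 2 / (n : ℝ) ^ 3 := by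
  have hn0 : 0 < n := by omega
  have hn' : (0 : ℝ) < n := Nat.cast_pos.2 hn0
  have hn2 : (2 : ℝ) ≤ n := by exact_mod_cast hn
  have hle : ∀ j, invSq n j ^ 2 ≤ 1 / (n : ℝ) ^ 2 * invSq n j := fun j => by
    rw [sq]
    exact mul_le_mul_of_nonneg_right (invSq_le hn0 j) (invSq_nonneg n j)
  have hs := (summable_invSq hn0).mul_left (1 / (n : ℝ) ^ 2)
  refine ((hs.of_nonneg_of_le (fun _ => sq_nonneg _) hle).tsum_le_tsum hle hs).trans ?_
  rw [tsum_mul_left, (hasSum_invSq hn0).tsum_eq]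
  have h := tsum_invSq_nat_le hn0
  calc _ ≤ 1 / (n : ℝ) ^ 2 * ((2 * n + 1) / (n : ℝ) ^ 2 +
        ((2 * n + 1) / (n : ℝ) ^ 2 - 1 / (n : ℝ) ^ 2)) := by gcongr
    _ = (4 * n + 1) / (n : ℝ) ^ 4 := by field_simp; ring
    _ ≤ _ := by
      -- The inequality reduces to 4n + 1 ≤ 9n/2, which needs n ≥ 2.
      rw [div_div, div_le_div_iff₀ (by positivity) (by positivity)]
      nlinarith [pow_pos hn' 3]

/-- On each half-line one factor of the squared difference is at most 2/n³, while the other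
telescopes to at most 1/n². -/
theorem tsum_sq_sub_invSq_le {n : ℕ} (hn : 0 < n) :
    ∑' j : ℤ, (invSq n j - invSq n (j - 1)) ^ 2 ≤ 4 / (n : ℝ) ^ 5 := by
  have hn' : (0 : ℝ) < n := Nat.cast_pos.2 hn
  set d : ℕ → ℝ := fun j => (invSq n j - invSq n ((j : ℤ) + 1)) ^ 2 with hd
  have hb : ∀ J, ∑ j ∈ Finset.range J, d j ≤ 2 / (n : ℝ) ^ 5 := by
    intro J
    have h1 : ∀ j : ℕ, d j ≤ 2 / (n : ℝ) ^ 3 * (invSq n j - invSq n ((j + 1 : ℕ) : ℤ)) := by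
      intro j
      obtain ⟨h0, h2⟩ := invSq_natCast_sub hn j
      rw [hd]
      push_cast
      simp only [sq]
      exact mul_le_mul_of_nonneg_right h2 h0
    refine (Finset.sum_le_sum fun j _ => h1 j).trans ?_
    rw [← Finset.mul_sum, Finset.sum_range_sub' (fun j : ℕ => invSq n (j : ℤ))]
    calc _ ≤ 2 / (n : ℝ) ^ 3 * (1 / (n : ℝ) ^ 2) := by
          gcongr
          exact (sub_le_self _ (invSq_nonneg _ _)).trans (invSq_le hn _)
      _ = _ := by field_simp
  have hs : Summable d := summable_of_sum_range_le (fun _ => sq_nonneg _) hb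
  have ht : ∑' j, d j ≤ 2 / (n : ℝ) ^ 5 := Real.tsum_le_of_sum_range_le (fun _ => sq_nonneg _) hb
  have key : HasSum (fun j : ℤ => (invSq n (j + 1) - invSq n j) ^ 2) (∑' j, d j + ∑' j, d j) := by
    refine HasSum.of_nat_of_neg_add_one ?_ ?_
    · convert hs.hasSum using 2 with j
      rw [hd]
      ring
    · convert hs.hasSum using 2 with j
      have e : -((j : ℤ) + 1) + 1 = -j := by ring
      rw [hd, e, invSq_neg, invSq_neg]
  have key' := (Equiv.subRight (1 : ℤ)).hasSum_iff.2 key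
  have e : (fun j : ℤ => (invSq n (j + 1) - invSq n j) ^ 2) ∘ (Equiv.subRight (1 : ℤ)) =
      fun j => (invSq n j - invSq n (j - 1)) ^ 2 := by
    ext j
    simp
  rw [e] at key'
  rw [key'.tsum_eq]
  calc _ ≤ 2 / (n : ℝ) ^ 5 + 2 / (n : ℝ) ^ 5 := add_le_add ht ht
    _ = _ := by ring

/-! ### The L¹ norm of the kernel -/

/-- A continuous kernel with Fourier coefficients `1 / j ^ 2` for `|j| ≥ n`. -/
def invSqKernel (n : ℕ) : C(T, ℂ) := ∑' j : ℤ, (invSq n j : ℂ) • (fourier j : C(T, ℂ))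

theorem fourierCoeff_invSqKernel {n : ℕ} (hn : 0 < n) (l : ℤ) :
    fourierCoeff (⇑(invSqKernel n)) l = invSq n l := by
  have hs : Summable fun j : ℤ => (invSq n j : ℂ) • (fourier j : C(T, ℂ)) := by
    refine Summable.of_norm ((summable_invSq hn).congr fun j => ?_)
    rw [norm_smul, fourier_norm, mul_one, Complex.norm_real, Real.norm_of_nonneg (invSq_nonneg n j)]
  rw [← coeffL_apply, invSqKernel, (coeffL l).map_tsum hs, tsum_eq_single l]
  · rw [map_smul, coeffL_apply, fourierCoeff_fourier, if_pos rfl, smul_eq_mul, mul_one]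
  · intro j hj
    rw [map_smul, coeffL_apply, fourierCoeff_fourier, if_neg hj, smul_zero]

/-- Parseval's identity for continuous functions on the circle. -/
theorem integral_norm_sq_eq_tsum (f : C(T, ℂ)) :
    ∫ t : T, ‖f t‖ ^ 2 ∂haarAddCircle = ∑' j : ℤ, ‖fourierCoeff (⇑f) j‖ ^ 2 := by
  have h := tsum_sq_fourierCoeff (ContinuousMap.toLp 2 (haarAddCircle (T := 2 * π)) ℂ f)
  simp only [fourierCoeff_toLp] at h
  rw [h]
  refine integral_congr_ae ?_
  filter_upwards [ContinuousMap.coeFn_toLp (𝕜 := ℂ) (p := 2) (haarAddCircle (T := 2 * π)) f]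
    with t ht
  rw [ht]

theorem le_norm_one_sub_fourier {x : ℝ} (hx : |x| ≤ π) :
    2 / π * |x| ≤ ‖1 - (fourier 1 (x : T) : ℂ)‖ := by
  have e : (fourier 1 (x : T) : ℂ) = Complex.exp (Complex.I * x) := by
    rw [fourier_coe_apply]
    congr 1
    have : (π : ℂ) ≠ 0 := Complex.ofReal_ne_zero.2 pi_ne_zero
    push_cast
    field_simp
  rw [norm_sub_rev, e, Complex.norm_exp_I_mul_ofReal_sub_one, norm_mul, Real.norm_eq_abs,
    Real.norm_eq_abs, abs_two]
  -- Jordan's inequality for the sine, applied to |1 - e^{ix}| = 2|sin(x/2)|.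
  have h := Real.mul_abs_le_abs_sin (x := x / 2) (by rw [abs_div, abs_two]; linarith)
  rw [abs_div, abs_two] at h
  calc _ = 2 * (2 / π * (|x| / 2)) := by ring
    _ ≤ _ := by gcongr

/-- By Jordan's inequality the weight dominates 1 + (cx)², whose reciprocal has integral at most
π/c; normalised measure divides by 2π. -/
theorem integral_inv_weight_le {c : ℝ} (hc : 0 < c) :
    ∫ t : T, (1 + c ^ 2 * π ^ 2 / 4 * ‖1 - (fourier 1 t : ℂ)‖ ^ 2)⁻¹ ∂haarAddCircle ≤
      1 / (2 * c) := by
  have hπ := pi_pos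
  rw [integral_haarAddCircle, ← AddCircle.intervalIntegral_preimage (2 * π) (-π)]
  rw [show -π + 2 * π = π by ring]
  have hw : ∀ x : ℝ, 0 < 1 + (c * x) ^ 2 := fun x => by positivity
  have h1 : ∫ x in (-π)..π, (1 + c ^ 2 * π ^ 2 / 4 * ‖1 - (fourier 1 (x : T) : ℂ)‖ ^ 2)⁻¹ ≤
      ∫ x in (-π)..π, (1 + (c * x) ^ 2)⁻¹ := by
    refine intervalIntegral.integral_mono_on (by linarith) ?_ ?_ fun x hx => ?_
    · refine Continuous.intervalIntegrable (Continuous.inv₀ ?_ fun x => ?_) _ _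
      · have : Continuous fun x : ℝ => (fourier 1 (x : T) : ℂ) :=
          (map_continuous (fourier 1)).comp (AddCircle.continuous_mk' _)
        fun_prop
      · positivity
    · exact Continuous.intervalIntegrable
        (Continuous.inv₀ (by fun_prop) fun x => (hw x).ne') _ _
    · have h := le_norm_one_sub_fourier (abs_le.2 hx)
      refine inv_anti₀ (hw x) ?_
      have h2 := pow_le_pow_left₀ (by positivity) h 2
      have e : (c * x) ^ 2 = c ^ 2 * π ^ 2 / 4 * (2 / π * |x|) ^ 2 := by
        rw [mul_pow (2 / π), sq_abs]
        field_simp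
        norm_num
      rw [e]
      gcongr
  have h2 : ∫ x in (-π)..π, (1 + (c * x) ^ 2)⁻¹ ≤ π / c := by
    rw [intervalIntegral.integral_comp_mul_left (fun x => (1 + x ^ 2)⁻¹) hc.ne',
      integral_inv_one_add_sq, smul_eq_mul, mul_neg, Real.arctan_neg, sub_neg_eq_add, div_eq_inv_mul]
    gcongr
    linarith [Real.arctan_lt_pi_div_two (c * π)]
  rw [smul_eq_mul]
  calc _ ≤ (2 * π)⁻¹ * (π / c) := by
        gcongr
        exact h1.trans h2
    _ = _ := by field_simp

theorem fourierCoeff_one_sub_fourier_mul (K : C(T, ℂ)) (l : ℤ) :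
    fourierCoeff (⇑((1 - fourier 1 : C(T, ℂ)) * K)) l = fourierCoeff (⇑K) l - fourierCoeff (⇑K) (l - 1) := by
  rw [sub_mul, one_mul, ← coeffL_apply, map_sub, coeffL_apply, coeffL_apply]
  congr 1
  refine integral_congr_ae (Filter.Eventually.of_forall fun t => ?_)
  simp only [smul_eq_mul, ContinuousMap.mul_apply]
  rw [← mul_assoc, ← fourier_add]
  congr 3
  ring

/-- A Carlson-type inequality. Multiplication by 1 - e^{it} differences the Fourier coefficients, so
Parseval evaluates the integral of |K|² against w = 1 + (c²π²/4)|1 - e^{it}|². The L¹ norm follows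
from 2|K| ≤ r w|K|² + 1/(r w); the parameter r replaces the square root of Cauchy–Schwarz. -/
theorem integral_norm_le_weighted (K : C(T, ℂ)) {c r : ℝ} (hc : 0 < c) (hr : 0 < r) :
    ∫ t : T, ‖K t‖ ∂haarAddCircle ≤
      (r * (∑' j : ℤ, ‖fourierCoeff (⇑K) j‖ ^ 2 + c ^ 2 * π ^ 2 / 4 *
        ∑' j : ℤ, ‖fourierCoeff (⇑K) j - fourierCoeff (⇑K) (j - 1)‖ ^ 2) + 1 / (2 * c) / r) / 2 := by
  set w : T → ℝ := fun t => 1 + c ^ 2 * π ^ 2 / 4 * ‖1 - (fourier 1 t : ℂ)‖ ^ 2 with hw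
  have hwpos : ∀ t, 0 < w t := fun t => by rw [hw]; positivity
  have hwc : Continuous w := by
    have := map_continuous (fourier 1 : C(T, ℂ))
    rw [hw]
    fun_prop
  have hwi : Continuous fun t => (w t)⁻¹ := hwc.inv₀ fun t => (hwpos t).ne'
  have hK : Continuous fun t => ‖K t‖ ^ 2 := by fun_prop
  have hD : Continuous fun t => ‖((1 - fourier 1 : C(T, ℂ)) * K) t‖ ^ 2 := by fun_prop
  have hpt : ∀ t, ‖K t‖ ≤ (r * (‖K t‖ ^ 2 + c ^ 2 * π ^ 2 / 4 * ‖((1 - fourier 1 : C(T, ℂ)) * K) t‖ ^ 2) +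
      (w t)⁻¹ / r) / 2 := by
    intro t
    have e : ‖K t‖ ^ 2 + c ^ 2 * π ^ 2 / 4 * ‖((1 - fourier 1 : C(T, ℂ)) * K) t‖ ^ 2 = ‖K t‖ ^ 2 * w t := by
      rw [ContinuousMap.mul_apply, norm_mul, hw, ContinuousMap.sub_apply, ContinuousMap.one_apply]
      ring
    rw [e]
    have hwt := hwpos t
    have h : 0 ≤ (r * w t * ‖K t‖ - 1) ^ 2 / (r * w t) := by positivity
    have e2 : (r * w t * ‖K t‖ - 1) ^ 2 / (r * w t) =
        r * (‖K t‖ ^ 2 * w t) + (w t)⁻¹ / r - 2 * ‖K t‖ := by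
      field_simp
      ring
    linarith
  have hi : ∀ u : T → ℝ, Continuous u → Integrable u (haarAddCircle (T := 2 * π)) :=
    fun u hu => integrable_of_continuous hu
  refine (integral_mono (hi _ (by fun_prop)) (hi _ (by fun_prop)) hpt).trans ?_
  rw [integral_div, integral_add (hi _ (by fun_prop)) (hi _ (by fun_prop)), integral_const_mul,
    integral_add (hi _ hK) (hi _ (by fun_prop)), integral_const_mul, integral_div,
    integral_norm_sq_eq_tsum, integral_norm_sq_eq_tsum]
  simp only [fourierCoeff_one_sub_fourier_mul]
  gcongr
  exact integral_inv_weight_le hc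

theorem integral_norm_invSqKernel_le {n : ℕ} (hn : 2 ≤ n) :
    ∫ t : T, ‖invSqKernel n t‖ ∂haarAddCircle ≤ 13 / 5 / (n : ℝ) ^ 2 := by
  have hn0 : 0 < n := by omega
  have hn' : (0 : ℝ) < n := Nat.cast_pos.2 hn0
  -- Rational values close to the minimisers in c/n and r/n; the resulting constant is about 2.58,
  -- below 13/5.
  refine (integral_norm_le_weighted (invSqKernel n) (c := 2 / 3 * n) (r := 29 / 100 * n)
    (by positivity) (by positivity)).trans ?_
  simp only [fourierCoeff_invSqKernel hn0, ← Complex.ofReal_sub, Complex.norm_real,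
    Real.norm_eq_abs, sq_abs]
  have h0 := tsum_sq_invSq_le hn
  have h1 := tsum_sq_sub_invSq_le hn0
  have hπ : π ^ 2 ≤ 9.8708 := by nlinarith [pi_lt_d4, pi_pos]
  calc _ ≤ (29 / 100 * n * (9 / 2 / (n : ℝ) ^ 3 + (2 / 3 * n) ^ 2 * 9.8708 / 4 *
          (4 / (n : ℝ) ^ 5)) + 1 / (2 * (2 / 3 * n)) / (29 / 100 * n)) / 2 := by
        gcongr
    _ ≤ _ := by
        have e : (29 / 100 * n * (9 / 2 / (n : ℝ) ^ 3 + (2 / 3 * n) ^ 2 * 9.8708 / 4 *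
          (4 / (n : ℝ) ^ 5)) + 1 / (2 * (2 / 3 * n)) / (29 / 100 * n)) / 2 =
          ((29 / 100 * (9 / 2 + 4 / 9 * 9.8708) + 75 / 29) / 2) / (n : ℝ) ^ 2 := by
          field_simp
          ring
        rw [e]
        exact div_le_div_of_nonneg_right (by norm_num) (by positivity)

/-! ### Symmetric differences and their triangular average -/

theorem fourier_coe_eq_exp (j : ℤ) (s : ℝ) :
    (fourier j (s : T) : ℂ) = Complex.exp ((j * s : ℝ) * Complex.I) := by
  rw [fourier_coe_apply]
  congr 1
  have : (π : ℂ) ≠ 0 := Complex.ofReal_ne_zero.2 pi_ne_zero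
  push_cast
  field_simp

/-- The symmetric difference as a continuous function. -/
def fdiff (r : ℕ) (h : ℝ) (f : C(T, ℂ)) : C(T, ℂ) :=
  ∑ i ∈ Finset.range (r + 1), ((-1 : ℂ) ^ (r - i) * (r.choose i : ℂ)) •
    translate ((-((r : ℝ) / 2) * h + (i : ℝ) * h : ℝ) : T) f

theorem fdiff_apply (r : ℕ) (h : ℝ) (f : C(T, ℂ)) (x : T) :
    fdiff r h f x = symmDiff r h f x := by
  simp only [fdiff, symmDiff, ContinuousMap.sum_apply, ContinuousMap.smul_apply, translate_apply,
    smul_eq_mul]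

theorem modulus_nonneg (r : ℕ) (f : C(T, ℂ)) (δ : ℝ) : 0 ≤ modulus r f δ :=
  Real.sSup_nonneg fun _ ⟨_, _, _, hy⟩ => hy ▸ norm_nonneg _

theorem norm_fdiff_le {r : ℕ} {h δ : ℝ} (f : C(T, ℂ)) (hh : |h| < δ) :
    ‖fdiff r h f‖ ≤ modulus r f δ :=
  (ContinuousMap.norm_le _ (modulus_nonneg _ _ _)).2 fun x =>
    le_csSup (modulus_bddAbove r f δ) ⟨x, h, hh, by rw [fdiff_apply]⟩

theorem continuous_fdiff (r : ℕ) (f : C(T, ℂ)) : Continuous fun h => fdiff r h f := by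
  unfold fdiff
  refine continuous_finsetSum _ fun i _ => ?_
  have h : Continuous fun h : ℝ => translate ((-((r : ℝ) / 2) * h + (i : ℝ) * h : ℝ) : T) f :=
    (continuous_translate f).comp ((AddCircle.continuous_mk' _).comp (by fun_prop))
  exact h.const_smul ((-1 : ℂ) ^ (r - i) * (r.choose i : ℂ))

theorem neg_one_pow_two_mul_sub {k i : ℕ} (hi : i ≤ 2 * k) :
    (-1 : ℂ) ^ (2 * k - i) = (-1) ^ i := by
  have h1 : (-1 : ℂ) ^ (2 * k - i) * (-1) ^ i = 1 := by
    rw [← pow_add, Nat.sub_add_cancel hi, pow_mul, neg_one_sq, one_pow]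
  have h2 : (-1 : ℂ) ^ i * (-1) ^ i = 1 := by rw [← mul_pow, neg_one_mul, neg_neg, one_pow]
  exact mul_right_cancel₀ (left_ne_zero_of_mul_eq_one h2) (h1.trans h2.symm)

/-- The reflection i ↦ 2k - i preserves the coefficients and conjugates the exponentials, so
averaging the sum with its reflection leaves cosines. -/
theorem sum_central_exp (k : ℕ) (y : ℝ) :
    ∑ i ∈ Finset.range (2 * k + 1), (-1 : ℂ) ^ (2 * k - i) * ((2 * k).choose i : ℂ) *
        Complex.exp ((((i : ℝ) - k) * y : ℝ) * Complex.I) =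
      ((∑ i ∈ Finset.range (2 * k + 1), (-1 : ℝ) ^ i * ((2 * k).choose i : ℝ) *
        cos (((i : ℝ) - k) * y) : ℝ) : ℂ) := by
  have hX : ∀ i ∈ Finset.range (2 * k + 1), (-1 : ℂ) ^ (2 * k - i) * ((2 * k).choose i : ℂ) *
      Complex.exp ((((i : ℝ) - k) * y : ℝ) * Complex.I) =
      (-1 : ℂ) ^ i * ((2 * k).choose i : ℂ) *
      Complex.exp ((((i : ℝ) - k) * y : ℝ) * Complex.I) := by
    intro i hi
    have hi' := Finset.mem_range_succ_iff.1 hi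
    rw [neg_one_pow_two_mul_sub hi']
  rw [Finset.sum_congr rfl hX]
  set X := ∑ i ∈ Finset.range (2 * k + 1), (-1 : ℂ) ^ i * ((2 * k).choose i : ℂ) *
      Complex.exp ((((i : ℝ) - k) * y : ℝ) * Complex.I) with hXdef
  have hrefl : X = ∑ i ∈ Finset.range (2 * k + 1), (-1 : ℂ) ^ i * ((2 * k).choose i : ℂ) *
      Complex.exp (-((((i : ℝ) - k) * y : ℝ) : ℂ) * Complex.I) := by
    rw [hXdef, ← Finset.sum_range_reflect]
    refine Finset.sum_congr rfl fun i hi => ?_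
    have hi' := Finset.mem_range_succ_iff.1 hi
    rw [show 2 * k + 1 - 1 - i = 2 * k - i by omega, Nat.choose_symm hi',
      neg_one_pow_two_mul_sub hi']
    congr 3
    rw [← Complex.ofReal_neg]
    congr 1
    push_cast [Nat.cast_sub hi']
    ring
  have h2 : 2 * X = 2 * ((∑ i ∈ Finset.range (2 * k + 1), (-1 : ℝ) ^ i * ((2 * k).choose i : ℝ) *
        cos (((i : ℝ) - k) * y) : ℝ) : ℂ) := by
    rw [two_mul X]
    nth_rewrite 2 [hrefl]
    rw [hXdef, ← Finset.sum_add_distrib, Complex.ofReal_sum, Finset.mul_sum]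
    refine Finset.sum_congr rfl fun i _ => ?_
    have hc : ((cos (((i : ℝ) - k) * y) : ℝ) : ℂ) =
        (Complex.exp ((((i : ℝ) - k) * y : ℝ) * Complex.I) +
          Complex.exp (-((((i : ℝ) - k) * y : ℝ) : ℂ) * Complex.I)) / 2 := by
      rw [Complex.ofReal_cos, Complex.cos]
    rw [Complex.ofReal_mul _ (cos _), hc]
    push_cast
    ring
  exact mul_left_cancel₀ two_ne_zero h2

theorem fourierCoeff_fdiff (k : ℕ) (h : ℝ) (f : C(T, ℂ)) (j : ℤ) :
    fourierCoeff (⇑(fdiff (2 * k) h f)) j =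
      ((∑ i ∈ Finset.range (2 * k + 1), (-1 : ℝ) ^ i * ((2 * k).choose i : ℝ) *
        cos (((i : ℝ) - k) * (j * h)) : ℝ) : ℂ) * fourierCoeff (⇑f) j := by
  rw [← coeffL_apply, fdiff, map_sum, ← sum_central_exp, Finset.sum_mul]
  refine Finset.sum_congr rfl fun i _ => ?_
  rw [map_smul, coeffL_apply, fourierCoeff_translate, fourier_coe_eq_exp, smul_eq_mul, mul_assoc,
    mul_assoc, mul_assoc]
  congr 5
  push_cast
  ring

/-- The average `∫_0^1 2 (1 - t) Δ_{th}^{2k} f dt`. -/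
def steklov (k : ℕ) (h : ℝ) (f : C(T, ℂ)) : C(T, ℂ) :=
  ∫ t in (0 : ℝ)..1, (2 * (1 - t)) • fdiff (2 * k) (t * h) f

theorem norm_steklov_le (k : ℕ) {h : ℝ} (hh : 0 < h) (f : C(T, ℂ)) :
    ‖steklov k h f‖ ≤ modulus (2 * k) f h := by
  have h1 : ∫ t in (0 : ℝ)..1, 2 * (1 - t) * modulus (2 * k) f h = modulus (2 * k) f h := by
    rw [intervalIntegral.integral_mul_const, intervalIntegral.integral_const_mul,
      intervalIntegral.integral_sub (by simp) (by simp)]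
    simp
    norm_num
  rw [← h1]
  refine intervalIntegral.norm_integral_le_of_norm_le zero_le_one
    (Filter.Eventually.of_forall fun t ht => ?_)
    (Continuous.intervalIntegrable (by fun_prop) _ _)
  have h0 : 0 ≤ 2 * (1 - t) := by linarith [ht.2]
  rw [norm_smul, Real.norm_of_nonneg h0]
  -- The modulus only admits steps strictly below h; at t = 1 the weight vanishes.
  rcases ht.2.lt_or_eq with h2 | h2
  · refine mul_le_mul_of_nonneg_left (norm_fdiff_le f ?_) h0
    rw [abs_of_pos (mul_pos ht.1 hh)]
    nlinarith
  · rw [h2]; simp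

/-- The cosine transform of the triangular weight. -/
def triangleCos (u : ℝ) : ℝ := ∫ t in (0 : ℝ)..1, 2 * (1 - t) * cos (t * u)

theorem triangleCos_zero : triangleCos 0 = 1 := by
  simp only [triangleCos, mul_zero, cos_zero, mul_one]
  rw [intervalIntegral.integral_const_mul, intervalIntegral.integral_sub (by simp) (by simp)]
  simp
  norm_num

theorem triangleCos_of_ne_zero {u : ℝ} (hu : u ≠ 0) : triangleCos u = (2 - 2 * cos u) / u ^ 2 := by
  have hd : ∀ t : ℝ, HasDerivAt (fun t => 2 * (1 - t) * sin (t * u) / u - 2 * cos (t * u) / u ^ 2)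
      (2 * (1 - t) * cos (t * u)) t := by
    intro t
    have hu' : HasDerivAt (fun t : ℝ => t * u) u t := by simpa using (hasDerivAt_id t).mul_const u
    have h1 : HasDerivAt (fun t : ℝ => 2 * (1 - t)) (-2) t := by
      simpa using ((hasDerivAt_id t).const_sub 1).const_mul 2
    convert! ((h1.mul hu'.sin).div_const u).sub ((hu'.cos.const_mul 2).div_const (u ^ 2)) using 1
    field_simp
    ring
  rw [triangleCos, intervalIntegral.integral_eq_sub_of_hasDerivAt (fun t _ => hd t)
    (Continuous.intervalIntegrable (by fun_prop) _ _)]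
  simp
  field_simp
  ring

theorem fourierCoeff_steklov (k : ℕ) (h : ℝ) (f : C(T, ℂ)) (j : ℤ) :
    fourierCoeff (⇑(steklov k h f)) j =
      ((∑ i ∈ Finset.range (2 * k + 1), (-1 : ℝ) ^ i * ((2 * k).choose i : ℝ) *
        triangleCos (((i : ℝ) - k) * (j * h)) : ℝ) : ℂ) * fourierCoeff (⇑f) j := by
  have hc : Continuous fun t : ℝ => (2 * (1 - t)) • fdiff (2 * k) (t * h) f :=
    by
    have h1 : Continuous fun t : ℝ => fdiff (2 * k) (t * h) f :=
      (continuous_fdiff (2 * k) f).comp (continuous_mul_const h)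
    fun_prop
  rw [← coeffL_apply, steklov, ← (coeffL j).intervalIntegral_comp_comm
    (hc.intervalIntegrable _ _)]
  have e : ∀ t : ℝ, coeffL j ((2 * (1 - t)) • fdiff (2 * k) (t * h) f) =
      ((∑ i ∈ Finset.range (2 * k + 1), (-1 : ℝ) ^ i * ((2 * k).choose i : ℝ) *
        (2 * (1 - t) * cos (t * (((i : ℝ) - k) * (j * h)))) : ℝ) : ℂ) * fourierCoeff (⇑f) j := by
    intro t
    rw [← Complex.coe_smul, map_smul, coeffL_apply, fourierCoeff_fdiff, smul_eq_mul, ← mul_assoc,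
      ← Complex.ofReal_mul, Finset.mul_sum]
    congr 2
    refine Finset.sum_congr rfl fun i _ => ?_
    rw [show ((i : ℝ) - k) * (j * (t * h)) = t * (((i : ℝ) - k) * (j * h)) by ring]
    ring
  simp only [e]
  rw [intervalIntegral.integral_mul_const, intervalIntegral.integral_ofReal,
    intervalIntegral.integral_finsetSum]
  · simp only [intervalIntegral.integral_const_mul, triangleCos]
  · exact fun i _ => Continuous.intervalIntegrable (by fun_prop) _ _

/-! ### Bounding a high-frequency function by its averaged difference -/

/-- The symmetric second difference `2 f - f (· + s) - f (· - s)`. -/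
def secondDiff (s : ℝ) (f : C(T, ℂ)) : C(T, ℂ) :=
  (2 : ℂ) • f - translate (s : T) f - translate ((-s : ℝ) : T) f

theorem norm_secondDiff_le (s : ℝ) (f : C(T, ℂ)) : ‖secondDiff s f‖ ≤ 4 * ‖f‖ := by
  refine (norm_sub_le _ _).trans ((add_le_add (norm_sub_le _ _) le_rfl).trans ?_)
  rw [norm_smul, Complex.norm_ofNat]
  linarith [norm_translate_le (s : T) f, norm_translate_le ((-s : ℝ) : T) f]

theorem fourierCoeff_secondDiff (s : ℝ) (f : C(T, ℂ)) (j : ℤ) :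
    fourierCoeff (⇑(secondDiff s f)) j = ((2 - 2 * cos (j * s) : ℝ) : ℂ) * fourierCoeff (⇑f) j := by
  rw [← coeffL_apply, secondDiff, map_sub, map_sub, map_smul, coeffL_apply, coeffL_apply,
    coeffL_apply, fourierCoeff_translate, fourierCoeff_translate, fourier_coe_eq_exp,
    fourier_coe_eq_exp, smul_eq_mul]
  push_cast
  rw [Complex.cos]
  ring_nf

/-- The largest noncentral coefficients are the neighbours of the middle, for which equality holds.
This gap makes the lower bound for the average possible. -/
theorem choose_le_of_ne_middle {k i : ℕ} (hi : i ≤ 2 * k) (hik : i ≠ k) :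
    (2 * k).choose i * (k + 1) ≤ k * (2 * k).choose k := by
  have hlow : ∀ i, i < k → (2 * k).choose i * (k + 1) ≤ k * (2 * k).choose k := by
    intro i hi
    have h1 : (2 * k).choose i ≤ (2 * k).choose (k - 1) := by
      have hle : i ≤ k - 1 := by omega
      refine Nat.decreasingInduction' (P := fun i => (2 * k).choose i ≤ (2 * k).choose (k - 1))
        (fun l hl _ ih => ?_) hle le_rfl
      exact (Nat.choose_le_succ_of_lt_half_left (by omega)).trans ih
    have h2 : (2 * k).choose (k - 1) = (2 * k).choose (k + 1) :=
      Nat.choose_symm_of_eq_add (by omega)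
    have h3 := Nat.choose_succ_right_eq (2 * k) k
    rw [show 2 * k - k = k by omega] at h3
    calc _ ≤ (2 * k).choose (k - 1) * (k + 1) := Nat.mul_le_mul_right _ h1
      _ = _ := by rw [h2, h3, mul_comm]
  rcases lt_or_gt_of_ne hik with h | h
  · exact hlow i h
  · rw [← Nat.choose_symm hi]
    exact hlow _ (by omega)

theorem sum_inv_sq_sub_le (k : ℕ) :
    ∑ i ∈ Finset.range (2 * k + 1), 1 / ((i : ℝ) - k) ^ 2 ≤ π ^ 2 / 3 := by
  -- The terms with zero denominator, here i = 0 and in the statement i = k, count as 0, since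
  -- division by zero gives 0.
  have hz : ∀ K : ℕ, ∑ i ∈ Finset.range K, 1 / (i : ℝ) ^ 2 ≤ π ^ 2 / 6 := fun K =>
    sum_le_hasSum _ (fun _ _ => by positivity) hasSum_zeta_two
  rw [show 2 * k + 1 = k + (k + 1) by ring, Finset.sum_range_add]
  have h1 : ∑ i ∈ Finset.range k, 1 / ((i : ℝ) - k) ^ 2 ≤ π ^ 2 / 6 := by
    refine le_trans (le_of_eq ?_) (hz (k + 1))
    rw [Finset.sum_range_succ', ← Finset.sum_range_reflect]
    simp only [Nat.cast_zero, ne_eq, OfNat.ofNat_ne_zero, not_false_eq_true, zero_pow, div_zero,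
      add_zero]
    refine Finset.sum_congr rfl fun i hi => ?_
    have hi' := Finset.mem_range.1 hi
    have e : ((k - 1 - i : ℕ) : ℝ) = k - 1 - i := by
      rw [Nat.cast_sub (by omega), Nat.cast_sub (by omega), Nat.cast_one]
    rw [e]
    push_cast
    congr 1
    ring
  have h2 : ∑ i ∈ Finset.range (k + 1), 1 / (((k + i : ℕ) : ℝ) - k) ^ 2 ≤ π ^ 2 / 6 := by
    refine le_trans (le_of_eq (Finset.sum_congr rfl fun i _ => ?_)) (hz (k + 1))
    push_cast
    congr 2
    ring
  linarith

/-- For functions without low frequencies, `steklov` is a multiple of the identity plus second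
differences of the second antiderivative. -/
theorem steklov_sub_smul_eq {k n : ℕ} {h : ℝ} (hn : 0 < n) (hh : 0 < h) {g : C(T, ℂ)}
    (hg : ∀ j : ℤ, |j| ≤ n → fourierCoeff (⇑g) j = 0) :
    steklov k h g - (((-1 : ℝ) ^ k * ((2 * k).choose k : ℝ) : ℝ) : ℂ) • g =
      ∑ i ∈ (Finset.range (2 * k + 1)).erase k,
        (((-1 : ℝ) ^ i * ((2 * k).choose i : ℝ) / (((i : ℝ) - k) * h) ^ 2 : ℝ) : ℂ) •
          secondDiff (((i : ℝ) - k) * h) (conv (invSqKernel n) g) := by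
  refine ext_fourierCoeff fun j => ?_
  rw [← coeffL_apply, ← coeffL_apply, map_sub, map_smul, map_sum, coeffL_apply, coeffL_apply,
    fourierCoeff_steklov]
  simp only [map_smul, coeffL_apply, fourierCoeff_secondDiff, fourierCoeff_conv, smul_eq_mul,
    fourierCoeff_invSqKernel hn]
  rcases le_or_gt |j| (n : ℤ) with hj | hj
  -- At low frequencies both sides vanish, so the artificial values of `invSq` there play no role.
  · simp [hg j hj]
  · have hj0 : (j : ℝ) ≠ 0 := by
      intro h0
      rw [Int.cast_eq_zero.1 h0, abs_zero] at hj
      omega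
    -- The term i = k has `triangleCos 0 = 1` and cancels the subtracted multiple of g.
    rw [← Finset.add_sum_erase _ _ (Finset.mem_range.2 (by omega : k < 2 * k + 1)), sub_self,
      zero_mul, triangleCos_zero, mul_one, ← sub_mul, ← Complex.ofReal_sub, add_sub_cancel_left,
      Complex.ofReal_sum, Finset.sum_mul]
    refine Finset.sum_congr rfl fun i hi => ?_
    have hik : (i : ℝ) - k ≠ 0 := sub_ne_zero.2 (Nat.cast_injective.ne (Finset.ne_of_mem_erase hi))
    rw [invSq_of_le hj.le, triangleCos_of_ne_zero (mul_ne_zero hik (mul_ne_zero hj0 hh.ne')),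
      show ((i : ℝ) - k) * (j * h) = j * (((i : ℝ) - k) * h) by ring, ← mul_assoc, ← mul_assoc,
      ← Complex.ofReal_mul, ← mul_assoc, ← Complex.ofReal_mul]
    congr 2
    field_simp

/-- The central term outweighs the rest: the remainder is at most k/(k + 1) of it, leaving the
fraction 1/(k + 1). The prescribed value of (hn)² is (2πα)². -/
theorem norm_le_norm_steklov {k n : ℕ} {h : ℝ} (hn : 2 ≤ n) (hh : 0 < h)
    (hhn : (h * n) ^ 2 = 3 * π ^ 4 / 8) {g : C(T, ℂ)}
    (hg : ∀ j : ℤ, |j| ≤ n → fourierCoeff (⇑g) j = 0) :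
    ((2 * k).choose k : ℝ) * ‖g‖ ≤ (k + 1) * ‖steklov k h g‖ := by
  have hn' : (0 : ℝ) < n := Nat.cast_pos.2 (by omega)
  have hk : (0 : ℝ) ≤ k := Nat.cast_nonneg k
  set C : ℝ := ((2 * k).choose k : ℝ) with hC
  have hC0 : 0 ≤ C := Nat.cast_nonneg _
  have h1 : C * ‖g‖ ≤ ‖steklov k h g‖ +
      ‖steklov k h g - (((-1 : ℝ) ^ k * C : ℝ) : ℂ) • g‖ := by
    have e : C * ‖g‖ = ‖(((-1 : ℝ) ^ k * C : ℝ) : ℂ) • g‖ := by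
      rw [norm_smul, Complex.norm_real, norm_mul, norm_pow, norm_neg, norm_one, one_pow, one_mul,
        Real.norm_of_nonneg hC0]
    rw [e]
    exact norm_le_insert _ _
  have hterm : ∀ i ∈ (Finset.range (2 * k + 1)).erase k,
      ‖(((-1 : ℝ) ^ i * ((2 * k).choose i : ℝ) / (((i : ℝ) - k) * h) ^ 2 : ℝ) : ℂ) •
          secondDiff (((i : ℝ) - k) * h) (conv (invSqKernel n) g)‖ ≤
        k / (k + 1) * C * (4 * (13 / 5) * (8 / (3 * π ^ 4)) * ‖g‖) * (1 / ((i : ℝ) - k) ^ 2) := by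
    intro i hi
    have hik : (i : ℝ) - k ≠ 0 := sub_ne_zero.2 (Nat.cast_injective.ne (Finset.ne_of_mem_erase hi))
    have hch : ((2 * k).choose i : ℝ) ≤ k / (k + 1) * C := by
      have := choose_le_of_ne_middle
        (Finset.mem_range_succ_iff.1 (Finset.mem_of_mem_erase hi)) (Finset.ne_of_mem_erase hi)
      rw [div_mul_eq_mul_div, le_div_iff₀ (by positivity), hC]
      exact_mod_cast this
    have hsd : ‖secondDiff (((i : ℝ) - k) * h) (conv (invSqKernel n) g)‖ ≤
        4 * (13 / 5 / (n : ℝ) ^ 2 * ‖g‖) :=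
      (norm_secondDiff_le _ _).trans (mul_le_mul_of_nonneg_left ((norm_conv_le _ _).trans
        (mul_le_mul_of_nonneg_right (integral_norm_invSqKernel_le hn) (norm_nonneg _))) (by norm_num))
    rw [norm_smul, Complex.norm_real, norm_div, norm_mul, norm_pow, norm_neg, norm_one, one_pow,
      one_mul, Real.norm_of_nonneg (Nat.cast_nonneg _), Real.norm_of_nonneg (sq_nonneg _)]
    calc _ ≤ k / (k + 1) * C / (((i : ℝ) - k) * h) ^ 2 * (4 * (13 / 5 / (n : ℝ) ^ 2 * ‖g‖)) := by
          gcongr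
      _ = k / (k + 1) * C * (4 * (13 / 5) * (1 / (h * n) ^ 2) * ‖g‖) * (1 / ((i : ℝ) - k) ^ 2) := by
          field_simp
      _ = _ := by
          rw [hhn, one_div_div]
  have h2 : ‖steklov k h g - (((-1 : ℝ) ^ k * C : ℝ) : ℂ) • g‖ ≤ k / (k + 1) * C * ‖g‖ := by
    rw [hC, steklov_sub_smul_eq (by omega) hh hg, ← hC]
    refine (norm_sum_le_of_le _ hterm).trans ?_
    rw [← Finset.mul_sum]
    have hs : ∑ i ∈ (Finset.range (2 * k + 1)).erase k, 1 / ((i : ℝ) - k) ^ 2 ≤ π ^ 2 / 3 :=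
      (Finset.sum_le_sum_of_subset_of_nonneg (Finset.erase_subset _ _)
        fun _ _ _ => by positivity).trans (sum_inv_sq_sub_le k)
    -- The factors are 4 for the second difference, 13/5 for the kernel, 1/(hn)² and Σ 1/(i - k)² ≤
    -- π²/3; their product is (416/45)/π², and 416/45 < 9.29 ≤ π².
    have hπ : 4 * (13 / 5) * (8 / (3 * π ^ 4)) * (π ^ 2 / 3) ≤ 1 := by
      have h9 : (9.29 : ℝ) ≤ π ^ 2 := by nlinarith [pi_gt_d2]
      have e : 4 * (13 / 5) * (8 / (3 * π ^ 4)) * (π ^ 2 / 3) = 416 / 45 / π ^ 2 := by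
        field_simp
        norm_num
      rw [e, div_le_one (by positivity)]
      norm_num at h9 ⊢
      linarith
    calc _ ≤ k / (k + 1) * C * (4 * (13 / 5) * (8 / (3 * π ^ 4)) * ‖g‖) * (π ^ 2 / 3) := by gcongr
      _ = k / (k + 1) * C * ‖g‖ * (4 * (13 / 5) * (8 / (3 * π ^ 4)) * (π ^ 2 / 3)) := by ring
      _ ≤ _ := mul_le_of_le_one_right (by positivity) hπ
  have h3 : C * ‖g‖ - k / (k + 1) * C * ‖g‖ = C * ‖g‖ / (k + 1) := by
    field_simp
    ring
  have h4 : C * ‖g‖ / (k + 1) ≤ ‖steklov k h g‖ := by linarith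
  rw [div_le_iff₀ (by positivity)] at h4
  linarith

/-- Both operators act as Fourier multipliers, hence commute. -/
theorem steklov_sub_vpMean (k m l : ℕ) (h : ℝ) (f : C(T, ℂ)) :
    steklov l h (f - vpMean k m f) = steklov l h f - vpMean k m (steklov l h f) := by
  refine ext_fourierCoeff fun j => ?_
  rw [fourierCoeff_steklov, fourierCoeff_sub_vpMean, fourierCoeff_sub_vpMean, fourierCoeff_steklov]
  ring

/-! ### The constant α and the conclusion -/

theorem alpha_pos : 0 < alpha := by
  have := pi_pos
  unfold alpha
  positivity

theorem alpha_sq : alpha ^ 2 = 3 * π ^ 2 / 32 := by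
  have h2 : ((2 : ℝ) ^ (-(5 / 2) : ℝ)) ^ 2 = 1 / 32 := by
    rw [← Real.rpow_natCast, ← Real.rpow_mul (by norm_num),
      show (-(5 / 2) : ℝ) * ((2 : ℕ) : ℝ) = ((-5 : ℤ) : ℝ) by norm_num, Real.rpow_intCast]
    norm_num
  have h3 : ((3 : ℝ) ^ (1 / 2 : ℝ)) ^ 2 = 3 := by
    rw [← Real.rpow_natCast, ← Real.rpow_mul (by norm_num),
      show (1 / 2 : ℝ) * ((2 : ℕ) : ℝ) = 1 by norm_num, Real.rpow_one]
  rw [alpha, mul_pow, mul_pow, h2, h3]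
  ring

end VallePoussin

end

open VallePoussin

theorem theorem3 (k m : ℕ) (hk : 1 ≤ k) (hm : 2 ≤ m) (f : C(VallePoussin.T, ℂ)) :
    ‖f - VallePoussin.vpMean k m f‖ ≤
      2 * ((k : ℝ) + 1) ^ 2 / ((2 * k).choose k : ℝ) *
        VallePoussin.modulus (2 * k) f (2 * π / ((k : ℝ) * (m : ℝ)) * VallePoussin.alpha) := by
  have hk' : (0 : ℝ) < k := Nat.cast_pos.2 (by omega)
  have hm' : (0 : ℝ) < m := Nat.cast_pos.2 (by omega)
  have hπ := pi_pos
  have hn : 2 ≤ k * m := by nlinarith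
  have hC : (0 : ℝ) < ((2 * k).choose k : ℝ) := Nat.cast_pos.2 (Nat.choose_pos (by omega))
  set h : ℝ := 2 * π / ((k : ℝ) * (m : ℝ)) * alpha with hh
  have hh0 : 0 < h := mul_pos (by positivity) alpha_pos
  have hhn : (h * (k * m : ℕ)) ^ 2 = 3 * π ^ 4 / 8 := by
    have e : h * (k * m : ℕ) = 2 * π * alpha := by
      rw [hh]
      push_cast
      field_simp
    rw [e, mul_pow, alpha_sq]
    ring
  have hg : ∀ j : ℤ, |j| ≤ (k * m : ℕ) → fourierCoeff (⇑(f - vpMean k m f)) j = 0 := by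
    intro j hj
    rw [fourierCoeff_sub_vpMean, vpMult_of_abs_le k m (by omega) hj, sub_self, zero_mul]
  have h1 := norm_le_norm_steklov (k := k) hn hh0 hhn hg
  have h2 : ‖steklov k h (f - vpMean k m f)‖ ≤ (2 * (k + 1)) * modulus (2 * k) f h := by
    rw [steklov_sub_vpMean]
    have h3 := norm_vpMean_le k m (by omega) (steklov k h f)
    -- The identity and the mean contribute 1 + (2k + 1) = 2(k + 1); the other factor k + 1 comes
    -- from `norm_le_norm_steklov`.
    calc _ ≤ ‖steklov k h f‖ + (2 * k + 1) * ‖steklov k h f‖ :=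
          (norm_sub_le _ _).trans (add_le_add_right h3 _)
      _ = 2 * (k + 1) * ‖steklov k h f‖ := by ring
      _ ≤ _ := by
          gcongr
          exact norm_steklov_le k hh0 f
  rw [div_mul_eq_mul_div, le_div_iff₀ hC, mul_comm]
  calc _ ≤ ((k : ℝ) + 1) * ‖steklov k h (f - vpMean k m f)‖ := h1
    _ ≤ ((k : ℝ) + 1) * ((2 * (k + 1)) * modulus (2 * k) f h) := by gcongr
    _ = _ := by ring
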